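/- Let $(M,\Pi)$ be a Poisson manifold of dimension $n$ (smooth, Hausdorff, second countable; $\Pi$ a smooth bivector field whose bracket $\{f,g\}=\Pi(\mathrm df,\mathrm dg)$ satisfies the Jacobi identity; $X_f=\{\cdot,f\}$ is the Hamiltonian vector field of $f$). Let $\mathfrak F$ be a smooth $r$-dimensional foliation of $M$, and put $s=n-r$. A *(local) first integral* of $\mathfrak F$ on an open set $U$ is a smooth function on $U$ that is constant on the leaves of $\mathfrak F|_U$. One says that $\mathfrak F$ is an *abstract NCI system* (abstract non-commutative integrable system of rank $r$) if every point of $M$ has an open neighborhood $U$ on which there exist first integrals $f_1,\dots,f_r$ of $\mathfrak F$ whose Hamiltonian vector fields span $T_{x}\mathfrak F$ at every $x\in U$. For $U\subset M$ open and $\mathbf F=(f_1,\dots,f_s):U\to\mathbb R^s$ smooth, $(U,\Pi|_U,\mathbf F)$ is a *regular NCI system of rank $r$* if $2s\geqslant n$, $\{f_i,f_j\}=0$ on $U$ for $1\leqslant i\leqslant r$ and $1\leqslant j\leqslant s$, and, at every point of $U$, $\mathrm df_1\wedge\dots\wedge \mathrm df_s\neq0$ and $X_{f_1}\wedge\dots\wedge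 X_{f_r}\neq0$. A *regular foliated atlas* of $\mathfrak F$ is a family $(U_\alpha,\psi_\alpha\times\phi_\alpha)_{\alpha\in I}$ such that the $U_\alpha$ form an open cover of $M$; each $\psi_\alpha\times\phi_\alpha$ is a foliated chart of $\mathfrak F$, i.e. a diffeomorphism of $U_\alpha$ onto a product of open rectangles in $\mathbb R^r$ and $\mathbb R^{s}$ such that the fibers of the submersion $\phi_\alpha:U_\alpha\to\mathbb R^{s}$ define the leaves of $\mathfrak F$ locally; and for all $\alpha,\beta\in I$ there is a (necessarily unique) diffeomorphism $\phi_{\alpha\beta}:\phi_\beta(U_\alpha\cap U_\beta)\to\phi_\alpha(U_\alpha\cap U_\beta)$ with $\phi_{\alpha\beta}\circ\phi_\beta=\phi_\alpha$ on $U_\alpha\cap U_\beta$. Then the following statements are equivalent: 1. $\mathfrak F$ is an abstract NCI system; 2. $\mathfrak F$ admits a regular foliated atlas $(U_\alpha,\psi_\alpha\times\phi_\alpha)_{\alpha\in I}$ such that, for every $\alpha\in I$, $(U_\alpha,\Pi|_{U_\alpha},\phi_\alpha)$ is a regular NCI system of rank $r$. -/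

import Mathlib

open Set Filter Topology
open scoped Manifold ContDiff

namespace NCI

noncomputable section

/-- Euclidean space of dimension `k`. -/
abbrev E (k : ℕ) : Type := EuclideanSpace ℝ (Fin k)

/-! ### Poisson structures -/

section Poisson

variable {n : ℕ} {M : Type*} [TopologicalSpace M] [ChartedSpace (E n) M]

/-- The tangent space of the `n`-dimensional manifold `M` at `m`. -/
abbrev Tan (n : ℕ) {M : Type*} [TopologicalSpace M] [ChartedSpace (E n) M] (m : M) : Type :=
  TangentSpace (𝓡 n) m

/-- The cotangent space of `M` at `m`. -/
abbrev Cotan (n : ℕ) {M : Type*} [TopologicalSpace M] [ChartedSpace (E n) M] (m : M) : Type :=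
  Module.Dual ℝ (Tan n m)

instance instFiniteDimensionalTan (m : M) : FiniteDimensional ℝ (Tan n m) :=
  inferInstanceAs (FiniteDimensional ℝ (E n))

/-- The differential `d_m f` of a real function, as a covector at `m`. -/
def diff (n : ℕ) {M : Type*} [TopologicalSpace M] [ChartedSpace (E n) M] (f : M → ℝ) (m : M) :
    Cotan n m :=
  ContinuousLinearMap.toLinearMap (M₂ := ℝ) (mfderiv (𝓡 n) 𝓘(ℝ, ℝ) f m)

/-- `f` is a smooth (`C^∞`) real function on the set `U`. -/
def SmoothOn (n : ℕ) {M : Type*} [TopologicalSpace M] [ChartedSpace (E n) M] (f : M → ℝ)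
    (U : Set M) : Prop :=
  ContMDiffOn (𝓡 n) 𝓘(ℝ, ℝ) ∞ f U

/-- A (not necessarily smooth) field of bilinear forms on the cotangent spaces. -/
abbrev BilinField (n : ℕ) (M : Type*) [TopologicalSpace M] [ChartedSpace (E n) M] : Type _ :=
  ∀ m : M, Cotan n m →ₗ[ℝ] Cotan n m →ₗ[ℝ] ℝ

/-- `{f, g}(m) = B_m(d_m f, d_m g)`. -/
def BilinField.bracket (B : BilinField n M) (f g : M → ℝ) (m : M) : ℝ :=
  B m (diff n f m) (diff n g m)

variable (n M) in
/-- A Poisson structure: a smooth bivector field `Π` whose bracket `{f, g} = Π(df, dg)` satisfies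
the Jacobi identity. A bivector at `m` is an alternating bilinear form on the cotangent space;
it depends smoothly on `m` iff it yields smooth functions on differentials of smooth functions. -/
structure PoissonStructure where
  bivector : BilinField n M
  alternating : ∀ (m : M) (α : Cotan n m), bivector m α α = 0
  smooth : ∀ (U : Set M), IsOpen U → ∀ f g : M → ℝ, SmoothOn n f U → SmoothOn n g U →
    SmoothOn n (bivector.bracket f g) U
  jacobi : ∀ (U : Set M), IsOpen U → ∀ f g h : M → ℝ,
    SmoothOn n f U → SmoothOn n g U → SmoothOn n h U → ∀ m ∈ U,
      bivector.bracket f (bivector.bracket g h) m + bivector.bracket g (bivector.bracket h f) m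
        + bivector.bracket h (bivector.bracket f g) m = 0

/-- The Poisson bracket. -/
def PoissonStructure.bracket (P : PoissonStructure n M) (f g : M → ℝ) : M → ℝ :=
  P.bivector.bracket f g

/-- The Hamiltonian vector field `X_f` at `m`: the tangent vector with
`⟨β, X_f⟩ = Π_m(β, d_m f)` for all covectors `β`, so that `X_f(g) = {g, f}`. -/
def PoissonStructure.ham (P : PoissonStructure n M) (f : M → ℝ) (m : M) : Tan n m :=
  (Module.evalEquiv ℝ (Tan n m)).symm ((P.bivector m).flip (diff n f m))

theorem PoissonStructure.apply_ham (P : PoissonStructure n M) (f : M → ℝ) (m : M)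
    (β : Cotan n m) : β (P.ham f m) = P.bivector m β (diff n f m) := by
  exact LinearMap.congr_fun ((Module.evalEquiv ℝ (Tan n m)).apply_symm_apply
    ((P.bivector m).flip (diff n f m))) β

/-! ### Non-commutative integrable systems -/

/-- The point `m` is regular for the tuple `f = (f_1, …, f_s)` (and the integer `r`):
`d f_1 ∧ … ∧ d f_s ≠ 0` and `X_{f_1} ∧ … ∧ X_{f_r} ≠ 0` at `m`. -/
def IsRegularPoint (P : PoissonStructure n M) (r : ℕ) {s : ℕ} (f : Fin s → M → ℝ) (m : M) :
    Prop :=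
  LinearIndependent ℝ (fun j : Fin s => diff n (f j) m) ∧
  LinearIndependent ℝ (fun i : {i : Fin s // (i : ℕ) < r} => P.ham (f i) m)

/-- `(U, Π|_U, f)` is a non-commutative integrable system of rank `r`, where `U` is an open
subset of `M` and `f = (f_1, …, f_s)` is an `s`-tuple of functions which are smooth on `U`
(their values outside `U` are irrelevant). -/
structure IsNCISystem (P : PoissonStructure n M) (r : ℕ) {s : ℕ} (U : Set M)
    (f : Fin s → M → ℝ) : Prop where
  isOpen : IsOpen U
  dim_le : n ≤ 2 * s
  rank_eq : r + s = n
  smooth : ∀ j, SmoothOn n (f j) U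
  involution : ∀ i j : Fin s, (i : ℕ) < r → ∀ m ∈ U, P.bracket (f i) (f j) m = 0
  dense_regular : ∃ D ⊆ U, IsOpen D ∧ U ⊆ closure D ∧ ∀ m ∈ D, IsRegularPoint P r f m

/-- A regular NCI system: all points are regular. -/
structure IsRegularNCISystem (P : PoissonStructure n M) (r : ℕ) {s : ℕ} (U : Set M)
    (f : Fin s → M → ℝ) : Prop extends IsNCISystem P r U f where
  regular : ∀ m ∈ U, IsRegularPoint P r f m

end Poisson

/-! ### Foliations -/

section Foliation

variable {n r s : ℕ} {M : Type*} [TopologicalSpace M] [ChartedSpace (E n) M]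

/-- An open rectangle in `ℝ^k`: a product of `k` open intervals, possibly unbounded. -/
def IsOpenBox {k : ℕ} (S : Set (E k)) : Prop :=
  ∃ J : Fin k → Set ℝ, (∀ i, IsOpen (J i) ∧ (J i).OrdConnected) ∧ S = {x | ∀ i, x i ∈ J i}

/-- A foliated chart `e = ψ × φ`: a diffeomorphism of an open subset of `M` onto a product of
open rectangles in `ℝ^r × ℝ^s`. Its plaques are the fibers of `φ`. -/
structure IsFoliatedChart (n : ℕ) {r s : ℕ} {M : Type*} [TopologicalSpace M]
    [ChartedSpace (E n) M] (e : OpenPartialHomeomorph M (E r × E s)) : Prop where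
  smooth : ContMDiffOn (𝓡 n) 𝓘(ℝ, E r × E s) ∞ e e.source
  smooth_symm : ContMDiffOn 𝓘(ℝ, E r × E s) (𝓡 n) ∞ e.symm e.target
  box : ∃ (S : Set (E r)) (T : Set (E s)), IsOpenBox S ∧ IsOpenBox T ∧ e.target = S ×ˢ T

/-- Two foliated charts are coherent if the intersection of any plaque of the one with any plaque
of the other is open in both plaques: near each common point `m`, the plaques through `m`
coincide. -/
def Coherent (e e' : OpenPartialHomeomorph M (E r × E s)) : Prop :=
  ∀ m ∈ e.source ∩ e'.source, ∀ᶠ x in 𝓝 m, ((e x).2 = (e m).2 ↔ (e' x).2 = (e' m).2)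

variable (n r s M) in
/-- A smooth foliation of `M` of dimension `r` and codimension `s`: a maximal atlas of pairwise
coherent foliated charts. -/
structure Foliation where
  charts : Set (OpenPartialHomeomorph M (E r × E s))
  foliated : ∀ e ∈ charts, IsFoliatedChart n e
  cover : ∀ m : M, ∃ e ∈ charts, m ∈ e.source
  coherent : ∀ e ∈ charts, ∀ e' ∈ charts, Coherent e e'
  maximal : ∀ e, IsFoliatedChart n e → (∀ e' ∈ charts, Coherent e e') → e ∈ charts

/-- A foliated chart around `m`. -/
def Foliation.chart (F : Foliation n r s M) (m : M) : OpenPartialHomeomorph M (E r × E s) :=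
  (F.cover m).choose

/-- The tangent space `T_m 𝔉` to the foliation: the kernel of `d_m φ`, for a foliated chart
`ψ × φ` around `m`. -/
def Foliation.tangent (F : Foliation n r s M) (m : M) : Submodule ℝ (Tan n m) :=
  LinearMap.ker (ContinuousLinearMap.toLinearMap (M₂ := E s)
    (mfderiv (𝓡 n) 𝓘(ℝ, E s) (fun x => (F.chart m x).2) m))

/-- `x` and `y` lie in a common plaque of the foliation, of a chart whose domain lies in `U`. -/
def Foliation.SamePlaque (F : Foliation n r s M) (U : Set M) (x y : M) : Prop :=
  ∃ e ∈ F.charts, e.source ⊆ U ∧ x ∈ e.source ∧ y ∈ e.source ∧ (e x).2 = (e y).2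

/-- For `U` open and `x`, `y` in `U`: the points `x` and `y` lie on the same leaf of the restricted
foliation `𝔉|_U`, i.e., they are joined by a chain of plaques in `U`. -/
def Foliation.SameLeaf (F : Foliation n r s M) (U : Set M) : M → M → Prop :=
  Relation.ReflTransGen (F.SamePlaque U)

/-- `f` is a (local) first integral of the foliation on `U`: a smooth function on `U` which is
constant on the leaves of `𝔉|_U`. -/
def Foliation.IsFirstIntegral (F : Foliation n r s M) (U : Set M) (f : M → ℝ) : Prop :=
  SmoothOn n f U ∧ ∀ x ∈ U, ∀ y ∈ U, F.SameLeaf U x y → f x = f y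

/-- `𝔉` is an abstract NCI system on `(M, Π)`: around every point there are `r` local first
integrals of `𝔉` whose Hamiltonian vector fields span the tangent bundle of `𝔉`. -/
def IsAbstractNCI (P : PoissonStructure n M) (F : Foliation n r s M) : Prop :=
  ∀ m : M, ∃ U : Set M, IsOpen U ∧ m ∈ U ∧ ∃ f : Fin r → M → ℝ,
    (∀ i, F.IsFirstIntegral U (f i)) ∧
    ∀ x ∈ U, Submodule.span ℝ (range fun i => P.ham (f i) x) = F.tangent x

/-- A regular foliated atlas of `𝔉`: a family `(U_α, ψ_α × φ_α)` of foliated charts of `𝔉` which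
covers `M` and such that any two of the submersions `φ_α` are linked by a diffeomorphism
`φ_αβ : φ_β(U_α ∩ U_β) → φ_α(U_α ∩ U_β)` with `φ_αβ ∘ φ_β = φ_α` on `U_α ∩ U_β`. -/
structure IsRegularFoliatedAtlas (F : Foliation n r s M)
    (A : Set (OpenPartialHomeomorph M (E r × E s))) : Prop where
  subset : A ⊆ F.charts
  cover : ∀ m : M, ∃ e ∈ A, m ∈ e.source
  transition : ∀ a ∈ A, ∀ b ∈ A, ∃ τ : OpenPartialHomeomorph (E s) (E s),
    τ.source = (fun x => (b x).2) '' (a.source ∩ b.source) ∧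
    τ.target = (fun x => (a x).2) '' (a.source ∩ b.source) ∧
    ContDiffOn ℝ ∞ τ τ.source ∧ ContDiffOn ℝ ∞ τ.symm τ.target ∧
    ∀ x ∈ a.source ∩ b.source, τ (b x).2 = (a x).2

/-- The components of the submersion `φ` of a foliated chart `ψ × φ`. -/
def submersion (e : OpenPartialHomeomorph M (E r × E s)) : Fin s → M → ℝ :=
  fun j x => (e x).2 j

end Foliation

end

end NCI

namespace NCI

/-! If the submersion of a chart is a regular NCI system, its components are first integrals.
Involution says that the first `r` Hamiltonian fields kill every component, so they are tangent to
the foliation; being independent, they span its `r`-dimensional tangent space.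

Conversely, `r` Hamiltonian fields spanning an `r`-dimensional space are independent, hence so are
the differentials of the first integrals `f i`. Locally `f i = g i ∘ φ`, so the `g i` can be
completed to coordinates `θ` on the transversal, and `θ ∘ φ` is the submersion of another chart of
the foliation (`IsAbstractNCI.exists_hamSpan`). There the first `r` fields are tangent to the leaves
and all components are constant along them, so the brackets vanish
(`Foliation.HamSpan.isRegularNCISystem`).

Such charts need not form a regular atlas: a plaque of one may meet several plaques of another.
Shrinking them by a Lebesgue-type function puts every chart that meets a given one inside a larger
chart extending it (`Foliation.exists_regularFoliatedAtlas`); the spanning condition survives, as it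
depends only on the germs of `φ`. -/

theorem isOpenBox_isOpen {k : ℕ} {S : Set (E k)} (hS : IsOpenBox S) : IsOpen S := by
  obtain ⟨J, hJ, rfl⟩ := hS
  rw [Set.ofPred_forall]
  exact isOpen_iInter_of_finite fun i => (hJ i).1.preimage (by fun_prop)

theorem isOpenBox_isPreconnected {k : ℕ} {S : Set (E k)} (hS : IsOpenBox S) :
    IsPreconnected S := by
  obtain ⟨J, hJ, rfl⟩ := hS
  refine Convex.isPreconnected ?_
  rw [Set.ofPred_forall]
  refine convex_iInter fun i => ?_
  exact ((hJ i).2.convex).is_linear_preimage (f := fun x : E k => x i)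
    ⟨fun _ _ => rfl, fun _ _ => rfl⟩

theorem exists_isOpenBox_subset {k : ℕ} {q : E k} {N : Set (E k)} (hN : N ∈ 𝓝 q) :
    ∃ S, IsOpenBox S ∧ q ∈ S ∧ S ⊆ N := by
  have h : (EuclideanSpace.equiv (Fin k) ℝ).symm ⁻¹' N ∈ 𝓝 (EuclideanSpace.equiv (Fin k) ℝ q) :=
    (EuclideanSpace.equiv (Fin k) ℝ).symm.continuous.continuousAt.preimage_mem_nhds (by simpa)
  obtain ⟨ε, hε, hb⟩ := Metric.mem_nhds_iff.1 h
  rw [ball_pi _ hε] at hb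
  refine ⟨{x | ∀ i, x i ∈ Metric.ball (q i) ε}, ⟨fun i => Metric.ball (q i) ε, fun i =>
    ⟨Metric.isOpen_ball, ?_⟩, rfl⟩, fun i => Metric.mem_ball_self hε, fun x hx => ?_⟩
  · simpa only [Real.ball_eq_Ioo] using ordConnected_Ioo
  · exact hb (fun i _ => hx i : EuclideanSpace.equiv (Fin k) ℝ x ∈ _)

/-! ### Foliated charts and the tangent bundle of a foliation -/

variable {n r s : ℕ} {M : Type*} [TopologicalSpace M] [ChartedSpace (E n) M]

namespace IsFoliatedChart

variable {e e' : OpenPartialHomeomorph M (E r × E s)} {m : M}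

theorem contMDiffAt (he : IsFoliatedChart n e) (hm : m ∈ e.source) :
    ContMDiffAt (𝓡 n) 𝓘(ℝ, E r × E s) ∞ e m :=
  he.smooth.contMDiffAt (e.open_source.mem_nhds hm)

theorem contMDiffAt_snd (he : IsFoliatedChart n e) (hm : m ∈ e.source) :
    ContMDiffAt (𝓡 n) 𝓘(ℝ, E s) ∞ (fun x => (e x).2) m :=
  (contDiff_snd (E := E r) (F := E s) (𝕜 := ℝ)).contMDiff.contMDiffAt.comp m (he.contMDiffAt hm)

theorem mdifferentiable (he : IsFoliatedChart n e) :
    e.MDifferentiable (𝓡 n) 𝓘(ℝ, E r × E s) :=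
  ⟨he.smooth.mdifferentiableOn (by simp), he.smooth_symm.mdifferentiableOn (by simp)⟩

theorem mfderiv_snd (he : IsFoliatedChart n e) (hm : m ∈ e.source) :
    mfderiv (𝓡 n) 𝓘(ℝ, E s) (fun x => (e x).2) m =
      (ContinuousLinearMap.snd ℝ (E r) (E s)).comp (mfderiv (𝓡 n) 𝓘(ℝ, E r × E s) e m) :=
  ((hasFDerivAt_snd (𝕜 := ℝ) (p := e m)).hasMFDerivAt.comp m
    ((he.contMDiffAt hm).mdifferentiableAt (by simp)).hasMFDerivAt).mfderiv

theorem mfderiv_snd_surjective (he : IsFoliatedChart n e)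
    (hm : m ∈ e.source) :
    Function.Surjective (mfderiv (𝓡 n) 𝓘(ℝ, E s) (fun x => (e x).2) m) := by
  rw [he.mfderiv_snd hm]
  exact Prod.snd_surjective.comp (he.mdifferentiable.mfderiv_surjective hm)

/-- By coherence, `φ' ∘ e⁻¹` is locally constant along the slice through `e m`, so its derivative
kills `E r × 0`, where `de` sends `ker dφ`. -/
theorem ker_le_of_coherent (he : IsFoliatedChart n e)
    (he' : IsFoliatedChart n e') (h : Coherent e e') (hm : m ∈ e.source) (hm' : m ∈ e'.source)
    (v : Tan n m) (hv : mfderiv (𝓡 n) 𝓘(ℝ, E s) (fun x => (e x).2) m v = 0) :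
    mfderiv (𝓡 n) 𝓘(ℝ, E s) (fun x => (e' x).2) m v = 0 := by
  set G : E r × E s → E s := fun y => (e' (e.symm y)).2 with hG
  have hem := e.map_source hm
  have hGd : DifferentiableAt ℝ G (e m) := by
    rw [← mdifferentiableAt_iff_differentiableAt]
    refine MDifferentiableAt.comp (I' := 𝓡 n) (e m) (g := fun x => (e' x).2) ?_
      (he.mdifferentiable.mdifferentiableAt_symm hem)
    rw [e.left_inv hm]
    exact (he'.contMDiffAt_snd hm').mdifferentiableAt (by simp)
  have h1 : mfderiv (𝓡 n) 𝓘(ℝ, E s) (fun x => (e' x).2) m =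
      (fderiv ℝ G (e m)).comp (mfderiv (𝓡 n) 𝓘(ℝ, E r × E s) e m) := by
    have h2 := (hGd.hasFDerivAt.hasMFDerivAt.comp m
      ((he.contMDiffAt hm).mdifferentiableAt (by simp)).hasMFDerivAt)
    refine (h2.congr_of_eventuallyEq ?_).mfderiv
    filter_upwards [e.open_source.mem_nhds hm] with x hx
    simp [hG, e.left_inv hx]
  rw [he.mfderiv_snd hm] at hv
  obtain ⟨w, hw⟩ : ∃ w : E r, mfderiv (𝓡 n) 𝓘(ℝ, E r × E s) e m v = (w, (0 : E s)) :=
    ⟨(mfderiv (𝓡 n) 𝓘(ℝ, E r × E s) e m v).1, Prod.ext rfl hv⟩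
  have h3 : HasFDerivAt (fun p : E r => G (p, (e m).2))
      ((fderiv ℝ G (e m)).comp (ContinuousLinearMap.inl ℝ (E r) (E s))) (e m).1 :=
    HasFDerivAt.comp (e m).1 (g := G) (f := fun p : E r => (p, (e m).2)) hGd.hasFDerivAt
      (hasFDerivAt_prodMk_left (e m).1 (e m).2)
  have h4 : (fun p : E r => G (p, (e m).2)) =ᶠ[𝓝 (e m).1] fun _ => (e' m).2 := by
    have hc : Tendsto (fun p : E r => e.symm (p, (e m).2)) (𝓝 (e m).1) (𝓝 m) := by
      have : ContinuousAt (fun p : E r => e.symm (p, (e m).2)) (e m).1 :=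
        ContinuousAt.comp (g := e.symm) (f := fun p : E r => (p, (e m).2))
          (e.continuousAt_symm hem) (by fun_prop)
      simpa [ContinuousAt, e.left_inv hm] using this
    have ht : ∀ᶠ p in 𝓝 (e m).1, (p, (e m).2) ∈ e.target :=
      (show ContinuousAt (fun p : E r => (p, (e m).2)) (e m).1 by fun_prop)
        (e.open_target.mem_nhds hem)
    filter_upwards [hc.eventually (h m ⟨hm, hm'⟩), ht] with p hp hpt
    refine hp.1 ?_
    rw [e.right_inv hpt]
  have h5 := h3.unique ((hasFDerivAt_const (e' m).2 (e m).1).congr_of_eventuallyEq h4)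
  have h6 := DFunLike.congr_fun h5 w
  rw [h1]
  change fderiv ℝ G (e m) (mfderiv (𝓡 n) 𝓘(ℝ, E r × E s) e m v) = 0
  rw [hw]
  simpa using h6

/-- On the domain of a smaller coherent chart `e'`, the submersion of `e` is constant on the
plaques of `e'`. -/
theorem snd_eq_of_snd_eq (he' : IsFoliatedChart n e') (h : Coherent e' e)
    (hsub : e'.source ⊆ e.source) {x y : M} (hx : x ∈ e'.source) (hy : y ∈ e'.source)
    (hxy : (e' x).2 = (e' y).2) : (e x).2 = (e y).2 := by
  obtain ⟨S, T, hS, hT, hST⟩ := he'.box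
  set q := (e' x).2
  have hq : q ∈ T := by
    have := e'.map_source hx
    rw [hST] at this
    exact this.2
  have hmem : ∀ p ∈ S, (p, q) ∈ e'.target := fun p hp => by rw [hST]; exact ⟨hp, hq⟩
  -- Coherence gives only local constancy along the plaque; the plaque is parametrized by the
  -- connected box `S`, which makes it global.
  have key : ∀ p ∈ S, ∀ᶠ p' in 𝓝[S] p, (e (e'.symm (p', q))).2 = (e (e'.symm (p, q))).2 := by
    intro p hp
    have hs := e'.map_target (hmem p hp)
    have hc : Tendsto (fun p' : E r => e'.symm (p', q)) (𝓝[S] p) (𝓝 (e'.symm (p, q))) :=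
      (ContinuousAt.comp (g := e'.symm) (f := fun p' : E r => (p', q))
        (e'.continuousAt_symm (hmem p hp)) (by fun_prop)).mono_left nhdsWithin_le_nhds
    filter_upwards [hc.eventually (h _ ⟨hs, hsub hs⟩), self_mem_nhdsWithin] with p' hp' hpS
    refine hp'.1 ?_
    rw [e'.right_inv (hmem p hp), e'.right_inv (hmem p' hpS)]
  have hpre := isOpenBox_isPreconnected hS
  have hconst : ∀ p ∈ S, ∀ p' ∈ S, (e (e'.symm (p, q))).2 = (e (e'.symm (p', q))).2 := by
    intro p hp p' hp'
    refine hpre.induction₂ (fun a b => (e (e'.symm (a, q))).2 = (e (e'.symm (b, q))).2)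
      (fun a ha => ?_) (fun a b c _ _ _ h1 h2 => h1.trans h2) (fun a b _ _ h1 => h1.symm) hp hp'
    filter_upwards [key a ha] with b hb using hb.symm
  have h1 := e'.map_source hx
  have h2 := e'.map_source hy
  rw [hST] at h1 h2
  have := hconst _ h1.1 _ h2.1
  have hy' : ((e' y).1, q) = e' y := Prod.ext rfl hxy
  have hx' : ((e' x).1, q) = e' x := rfl
  rwa [hy', hx', e'.left_inv hx, e'.left_inv hy] at this

end IsFoliatedChart

namespace Foliation

variable (F : Foliation n r s M) {e : OpenPartialHomeomorph M (E r × E s)} {m : M}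

/-- Coherence, used in both directions, frees the tangent space from the chart chosen in its
definition. -/
theorem mem_tangent_iff (he : e ∈ F.charts) (hm : m ∈ e.source)
    (v : Tan n m) :
    v ∈ F.tangent m ↔ mfderiv (𝓡 n) 𝓘(ℝ, E s) (fun x => (e x).2) m v = 0 := by
  have hc : F.chart m ∈ F.charts ∧ m ∈ (F.chart m).source := (F.cover m).choose_spec
  exact ⟨(F.foliated _ hc.1).ker_le_of_coherent (F.foliated _ he) (F.coherent _ hc.1 _ he)
      hc.2 hm v,
    (F.foliated _ he).ker_le_of_coherent (F.foliated _ hc.1) (F.coherent _ he _ hc.1) hm hc.2 v⟩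

theorem finrank_tangent (hrs : r + s = n) (m : M) :
    Module.finrank ℝ (F.tangent m) = r := by
  have hc : F.chart m ∈ F.charts ∧ m ∈ (F.chart m).source := (F.cover m).choose_spec
  let L : E n →ₗ[ℝ] E s := ContinuousLinearMap.toLinearMap (M := E n) (M₂ := E s)
    (mfderiv (𝓡 n) 𝓘(ℝ, E s) (fun x => (F.chart m x).2) m)
  have hL : LinearMap.range L = ⊤ :=
    LinearMap.range_eq_top.2 ((F.foliated _ hc.1).mfderiv_snd_surjective hc.2)
  have h := L.finrank_range_add_finrank_ker
  rw [hL, finrank_top, finrank_euclideanSpace_fin, finrank_euclideanSpace_fin] at h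
  change s + Module.finrank ℝ (F.tangent m) = n at h
  omega

end Foliation

theorem diff_submersion {e : OpenPartialHomeomorph M (E r × E s)} (he : IsFoliatedChart n e)
    {m : M} (hm : m ∈ e.source) (j : Fin s) (v : Tan n m) :
    diff n (submersion e j) m v =
      (show E s from mfderiv (𝓡 n) 𝓘(ℝ, E s) (fun x => (e x).2) m v) j := by
  have h := ((EuclideanSpace.proj (𝕜 := ℝ) j : E s →L[ℝ] ℝ).hasFDerivAt
    (x := (e m).2)).hasMFDerivAt.comp m
      ((he.contMDiffAt_snd hm).mdifferentiableAt (by simp)).hasMFDerivAt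
  have h1 : mfderiv (𝓡 n) 𝓘(ℝ, ℝ) (submersion e j) m = _ := h.mfderiv
  rw [diff, h1]
  rfl

theorem linearIndependent_diff_submersion
    {e : OpenPartialHomeomorph M (E r × E s)} (he : IsFoliatedChart n e)
    {m : M} (hm : m ∈ e.source) :
    LinearIndependent ℝ (fun j => diff n (submersion e j) m) := by
  rw [Fintype.linearIndependent_iff]
  intro c hc i
  obtain ⟨v, hv⟩ := he.mfderiv_snd_surjective hm (EuclideanSpace.single i (1 : ℝ))
  have h := DFunLike.congr_fun hc v
  simpa [LinearMap.sum_apply, diff_submersion he hm, hv, Pi.single_apply] using h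

theorem smoothOn_submersion {e : OpenPartialHomeomorph M (E r × E s)} (he : IsFoliatedChart n e)
    (j : Fin s) : SmoothOn n (submersion e j) e.source := fun m hm =>
  (((EuclideanSpace.proj (𝕜 := ℝ) j : E s →L[ℝ] ℝ).contDiff.contMDiff.contMDiffAt).comp m
    (he.contMDiffAt_snd hm)).contMDiffWithinAt

/-! ### Changing, shrinking and comparing charts -/

/-- A foliated chart around `m` can be restricted to a small foliated chart around `m`, with its
submersion composed with a local diffeomorphism `θ`. -/
theorem Foliation.exists_chart_comp (F : Foliation n r s M)
    {e : OpenPartialHomeomorph M (E r × E s)} (he : e ∈ F.charts) {m : M} (hm : m ∈ e.source)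
    (θ : OpenPartialHomeomorph (E s) (E s)) (hθ : ContDiffOn ℝ ∞ θ θ.source)
    (hθ' : ContDiffOn ℝ ∞ θ.symm θ.target) (hmθ : (e m).2 ∈ θ.source) {W : Set M}
    (hW : W ∈ 𝓝 m) :
    ∃ e' ∈ F.charts, m ∈ e'.source ∧ e'.source ⊆ W ∧ e'.source ⊆ e.source ∧
      ∀ x ∈ e'.source, (e x).2 ∈ θ.source ∧ (e' x).2 = θ (e x).2 := by
  have hef := F.foliated e he
  set Θ := (OpenPartialHomeomorph.refl (E r)).prod θ with hΘ
  have hΘs : ContDiffOn ℝ ∞ Θ Θ.source :=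
    contDiff_fst.contDiffOn.prodMk (hθ.comp contDiff_snd.contDiffOn fun x hx => hx.2)
  have hΘt : ContDiffOn ℝ ∞ Θ.symm Θ.target :=
    contDiff_fst.contDiffOn.prodMk (hθ'.comp contDiff_snd.contDiffOn fun x hx => hx.2)
  set e₁ := e.trans Θ with he₁
  have hm₁ : m ∈ e₁.source := by
    rw [he₁, OpenPartialHomeomorph.trans_source]
    exact ⟨hm, mem_univ _, hmθ⟩
  have hN : e₁.target ∩ e₁.symm ⁻¹' W ∈ 𝓝 (e₁ m) := by
    refine inter_mem (e₁.open_target.mem_nhds (e₁.map_source hm₁)) ?_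
    refine (e₁.continuousAt_symm (e₁.map_source hm₁)).preimage_mem_nhds ?_
    rwa [e₁.left_inv hm₁]
  obtain ⟨A, hA, B, hB, hAB⟩ := mem_nhds_prod_iff.1 hN
  obtain ⟨S, hS, hmS, hSA⟩ := exists_isOpenBox_subset hA
  obtain ⟨T, hT, hmT, hTB⟩ := exists_isOpenBox_subset hB
  have hST : S ×ˢ T ⊆ e₁.target ∩ e₁.symm ⁻¹' W := (prod_mono hSA hTB).trans hAB
  -- The restriction is made on the target side, so that the image is exactly a product of boxes.
  set e' := (e₁.symm.restrOpen (S ×ˢ T)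
    ((isOpenBox_isOpen hS).prod (isOpenBox_isOpen hT))).symm with he'
  have htarget : e'.target = S ×ˢ T := by
    change e₁.target ∩ S ×ˢ T = S ×ˢ T
    exact inter_eq_right.2 fun x hx => (hST hx).1
  have hsub : ∀ x ∈ e'.source, x ∈ e.source ∧ (e x).2 ∈ θ.source := by
    intro x hx
    have h := hx.1
    change x ∈ e₁.source at h
    rw [he₁, OpenPartialHomeomorph.trans_source] at h
    exact ⟨h.1, h.2.2⟩
  have hval : ∀ x, (e' x).2 = θ (e x).2 := fun x => rfl
  refine ⟨e', F.maximal e' ⟨?_, ?_, S, T, hS, hT, htarget⟩ ?_, ?_, ?_, fun x hx => (hsub x hx).1,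
    fun x hx => ⟨(hsub x hx).2, hval x⟩⟩
  · exact hΘs.contMDiffOn.comp (hef.smooth.mono fun x hx => (hsub x hx).1)
      fun x hx => ⟨mem_univ _, (hsub x hx).2⟩
  · refine hef.smooth_symm.comp (hΘt.contMDiffOn.mono ?_) ?_
    · intro y hy
      rw [htarget] at hy
      have := (hST hy).1
      rw [he₁, OpenPartialHomeomorph.trans_target] at this
      exact this.1
    · intro y hy
      rw [htarget] at hy
      have := (hST hy).1
      rw [he₁, OpenPartialHomeomorph.trans_target] at this
      exact this.2
  -- As `θ` is injective on its source, the plaques are unchanged locally and coherence is inherited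
  -- from `e`.
  · intro e'' he'' x hx
    filter_upwards [F.coherent e he e'' he'' x ⟨(hsub x hx.1).1, hx.2⟩,
      e'.open_source.mem_nhds hx.1] with y hy hys
    rw [← hy, hval, hval]
    exact θ.injOn.eq_iff (hsub y hys).2 (hsub x hx.1).2
  · exact ⟨hm₁, hmS, hmT⟩
  · intro x hx
    have h := (hST hx.2).2
    rwa [mem_preimage, OpenPartialHomeomorph.symm_symm, e₁.left_inv hx.1] at h

/-- A foliated chart around `m` can be restricted to a small foliated chart around `m`. -/
theorem Foliation.exists_chart_subset (F : Foliation n r s M)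
    {e : OpenPartialHomeomorph M (E r × E s)} (he : e ∈ F.charts) {m : M} (hm : m ∈ e.source)
    {W : Set M} (hW : W ∈ 𝓝 m) :
    ∃ e' ∈ F.charts, m ∈ e'.source ∧ e'.source ⊆ W ∧ e'.source ⊆ e.source ∧
      ∀ x ∈ e'.source, (e' x).2 = (e x).2 := by
  obtain ⟨e', h1, h2, h3, h4, h5⟩ := F.exists_chart_comp he hm (OpenPartialHomeomorph.refl _)
    contDiff_id.contDiffOn contDiff_id.contDiffOn (mem_univ _) hW
  exact ⟨e', h1, h2, h3, h4, fun x hx => (h5 x hx).2⟩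

/-- If the submersions of two charts have the same fibers on the intersection of the domains, they
are linked by a diffeomorphism. -/
theorem Foliation.exists_transition (F : Foliation n r s M)
    {a b : OpenPartialHomeomorph M (E r × E s)} (ha : a ∈ F.charts) (hb : b ∈ F.charts)
    (hab : ∀ x ∈ a.source, ∀ y ∈ a.source, y ∈ b.source → x ∈ b.source →
      (a x).2 = (a y).2 → (b x).2 = (b y).2)
    (hba : ∀ x ∈ a.source, ∀ y ∈ a.source, y ∈ b.source → x ∈ b.source →
      (b x).2 = (b y).2 → (a x).2 = (a y).2) :
    ∃ τ : OpenPartialHomeomorph (E s) (E s),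
      τ.source = (fun x => (b x).2) '' (a.source ∩ b.source) ∧
      τ.target = (fun x => (a x).2) '' (a.source ∩ b.source) ∧
      ContDiffOn ℝ ∞ τ τ.source ∧ ContDiffOn ℝ ∞ τ.symm τ.target ∧
      ∀ x ∈ a.source ∩ b.source, τ (b x).2 = (a x).2 := by
  -- the map `φ_c x ↦ φ_d x`
  have key : ∀ c ∈ F.charts, ∀ d ∈ F.charts,
      (∀ x ∈ c.source ∩ d.source, ∀ y ∈ c.source ∩ d.source, (c x).2 = (c y).2 →
        (d x).2 = (d y).2) →
      IsOpen ((fun x => (c x).2) '' (c.source ∩ d.source)) ∧ ∃ g : E s → E s,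
        ContDiffOn ℝ ∞ g ((fun x => (c x).2) '' (c.source ∩ d.source)) ∧
        ∀ x ∈ c.source ∩ d.source, g (c x).2 = (d x).2 := by
    intro c hc d hd hcd
    have hcf := F.foliated c hc
    have hdf := F.foliated d hd
    have hopen : IsOpen ((fun x => (c x).2) '' (c.source ∩ d.source)) := by
      have h1 : IsOpen (c '' (c.source ∩ d.source)) :=
        c.isOpen_image_of_subset_source (c.open_source.inter d.open_source) inter_subset_left
      have h2 := isOpenMap_snd _ h1
      rwa [image_image] at h2
    refine ⟨hopen, ?_⟩
    classical
    have hex : ∃ g : E s → E s, ∀ x ∈ c.source ∩ d.source, g (c x).2 = (d x).2 := by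
      -- The choice of preimage is harmless by `hcd`; the value `0` off the image plays no role.
      refine ⟨fun q => if h : ∃ x ∈ c.source ∩ d.source, (c x).2 = q then (d h.choose).2 else 0,
        fun x hx => ?_⟩
      have h : ∃ y ∈ c.source ∩ d.source, (c y).2 = (c x).2 := ⟨x, hx, rfl⟩
      beta_reduce
      rw [dif_pos h]
      exact hcd _ h.choose_spec.1 _ hx h.choose_spec.2
    obtain ⟨g, hg⟩ := hex
    refine ⟨g, ?_, hg⟩
    rintro _ ⟨x, hx, rfl⟩
    refine ContDiffAt.contDiffWithinAt ?_
    have hcx := c.map_source hx.1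
    -- Near `(c x).2` the map `g` is `φ_d` evaluated along the transversal of `c` through `x`, hence
    -- smooth.
    have hsm : ContMDiffAt 𝓘(ℝ, E s) 𝓘(ℝ, E s) ∞
        (fun q : E s => (d (c.symm ((c x).1, q))).2) (c x).2 := by
      have h1 : ContMDiffAt 𝓘(ℝ, E s) 𝓘(ℝ, E r × E s) ∞ (fun q : E s => ((c x).1, q)) (c x).2 :=
        (contDiff_const.prodMk contDiff_id).contMDiff.contMDiffAt
      have h2 : ContMDiffAt 𝓘(ℝ, E s) (𝓡 n) ∞ (fun q : E s => c.symm ((c x).1, q)) (c x).2 :=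
        ContMDiffAt.comp (c x).2 (g := c.symm)
          (hcf.smooth_symm.contMDiffAt (c.open_target.mem_nhds hcx)) h1
      refine ContMDiffAt.comp (c x).2 (g := fun y => (d y).2) ?_ h2
      rw [show c.symm ((c x).1, (c x).2) = x from c.left_inv hx.1]
      exact hdf.contMDiffAt_snd hx.2
    refine hsm.contDiffAt.congr_of_eventuallyEq ?_
    have hct : ContinuousAt (fun q : E s => ((c x).1, q)) (c x).2 := by fun_prop
    have hcc : ContinuousAt (fun q : E s => c.symm ((c x).1, q)) (c x).2 :=
      ContinuousAt.comp (g := c.symm) (c.continuousAt_symm hcx) hct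
    filter_upwards [hct.preimage_mem_nhds (c.open_target.mem_nhds hcx),
      hcc.preimage_mem_nhds (d.open_source.mem_nhds
        (by rw [show c.symm ((c x).1, (c x).2) = x from c.left_inv hx.1]; exact hx.2))]
      with q hq1 hq2
    have := hg _ ⟨c.map_target hq1, hq2⟩
    rwa [c.right_inv hq1] at this
  obtain ⟨ho₁, g₁, hg₁, hv₁⟩ := key b hb a ha
    (fun x hx y hy => hba x hx.2 y hy.2 hy.1 hx.1)
  obtain ⟨ho₂, g₂, hg₂, hv₂⟩ := key a ha b hb
    (fun x hx y hy => hab x hx.1 y hy.1 hy.2 hx.2)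
  rw [inter_comm] at ho₁ hg₁ hv₁
  refine ⟨{ toFun := g₁, invFun := g₂, source := (fun x => (b x).2) '' (a.source ∩ b.source),
            target := (fun x => (a x).2) '' (a.source ∩ b.source), map_source' := ?_,
            map_target' := ?_, left_inv' := ?_, right_inv' := ?_, open_source := ho₁,
            open_target := ho₂, continuousOn_toFun := hg₁.continuousOn,
            continuousOn_invFun := hg₂.continuousOn }, rfl, rfl, hg₁, hg₂, hv₁⟩
  · rintro _ ⟨x, hx, rfl⟩
    exact ⟨x, hx, (hv₁ x hx).symm⟩
  · rintro _ ⟨x, hx, rfl⟩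
    exact ⟨x, hx, (hv₂ x hx).symm⟩
  · rintro _ ⟨x, hx, rfl⟩
    beta_reduce
    rw [hv₁ x hx, hv₂ x hx]
  · rintro _ ⟨x, hx, rfl⟩
    beta_reduce
    rw [hv₂ x hx, hv₁ x hx]

/-! ### Extraction of a regular foliated atlas -/

/-- From charts around all points, taken in a class `Q` that is stable under restriction, one can
extract a regular foliated atlas. -/
theorem Foliation.exists_regularFoliatedAtlas [T2Space M] [SecondCountableTopology M]
    (F : Foliation n r s M) (Q : OpenPartialHomeomorph M (E r × E s) → Prop)
    (hQ : ∀ e ∈ F.charts, Q e → ∀ e' ∈ F.charts, e'.source ⊆ e.source →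
      (∀ x ∈ e'.source, (e' x).2 = (e x).2) → Q e')
    (hex : ∀ m : M, ∃ e ∈ F.charts, m ∈ e.source ∧ Q e) :
    ∃ A, IsRegularFoliatedAtlas F A ∧ ∀ e ∈ A, Q e := by
  have : LocallyCompactSpace M := ChartedSpace.locallyCompactSpace (E n) M
  have : TopologicalSpace.MetrizableSpace M := Manifold.metrizableSpace (𝓡 n) M
  let : MetricSpace M := TopologicalSpace.metrizableSpaceMetric M
  -- The supremum of these radii is a positive, 1-Lipschitz local Lebesgue number; the bound `δ ≤ 1`
  -- keeps it finite.
  let D : M → Set ℝ := fun m => {δ | 0 < δ ∧ δ ≤ 1 ∧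
    ∃ e ∈ F.charts, Q e ∧ Metric.ball m δ ⊆ e.source}
  have hDne : ∀ m, (D m).Nonempty := by
    intro m
    obtain ⟨e, he, hme, hQe⟩ := hex m
    obtain ⟨ε, hε, hb⟩ := Metric.mem_nhds_iff.1 (e.open_source.mem_nhds hme)
    exact ⟨min ε 1, by positivity, min_le_right _ _, e, he, hQe,
      (Metric.ball_subset_ball (min_le_left _ _)).trans hb⟩
  have hDb : ∀ m, BddAbove (D m) := fun m => ⟨1, fun δ hδ => hδ.2.1⟩
  let d : M → ℝ := fun m => sSup (D m)
  have hd : ∀ m, 0 < d m := fun m => by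
    obtain ⟨δ, hδ⟩ := hDne m
    exact hδ.1.trans_le (le_csSup (hDb m) hδ)
  have hlip : ∀ x y, d x ≤ d y + dist x y := by
    intro x y
    refine csSup_le (hDne x) fun δ hδ => ?_
    by_cases h : δ ≤ dist x y
    · linarith [hd y]
    · push Not at h
      obtain ⟨h0, h1, e, he, hQe, hb⟩ := hδ
      have : δ - dist x y ∈ D y := ⟨by linarith, by linarith [dist_nonneg (x := x) (y := y)],
        e, he, hQe, (Metric.ball_subset_ball' (by rw [dist_comm y x]; linarith)).trans hb⟩
      linarith [le_csSup (hDb y) this]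
  -- The supremum may not be attained, so half of it is used.
  have hV : ∀ m, ∃ e ∈ F.charts, Q e ∧ Metric.ball m (d m / 2) ⊆ e.source := by
    intro m
    obtain ⟨δ, ⟨h0, h1, e, he, hQe, hb⟩, hlt⟩ :=
      exists_lt_of_lt_csSup (hDne m) (show d m / 2 < sSup (D m) from half_lt_self (hd m))
    exact ⟨e, he, hQe, (Metric.ball_subset_ball hlt.le).trans hb⟩
  choose V hVF hVQ hVb using hV
  -- If the small balls at `x` and `y` meet, the Lipschitz bound gives `d y ≤ (21/19) d x`, so the
  -- one at `y` lies within `(d x + 2 d y)/20 < d x / 2` of `x`. The constant 20 is not sharp.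
  have hU : ∀ m, ∃ e' ∈ F.charts, m ∈ e'.source ∧ e'.source ⊆ Metric.ball m (d m / 20) ∧
      e'.source ⊆ (V m).source ∧ ∀ x ∈ e'.source, (e' x).2 = ((V m) x).2 := fun m =>
    F.exists_chart_subset (hVF m) (hVb m (Metric.mem_ball_self (half_pos (hd m))))
      (Metric.ball_mem_nhds m (by linarith [hd m]))
  choose U hUF hmU hUb hUV hUe using hU
  -- if `U x` and `U y` meet, then `U y` is contained in `V x`
  have hUUV : ∀ x y z, z ∈ (U x).source → z ∈ (U y).source → (U y).source ⊆ (V x).source := by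
    intro x y z hzx hzy w hw
    refine hVb x ?_
    have h1 := Metric.mem_ball.1 (hUb x hzx)
    have h2 := Metric.mem_ball.1 (hUb y hzy)
    have h3 := Metric.mem_ball.1 (hUb y hw)
    have h4 := hlip y x
    have h5 : dist y x ≤ dist z y + dist z x := by
      rw [dist_comm z y]; exact dist_triangle _ _ _
    have h6 := dist_triangle w y x
    rw [Metric.mem_ball]
    linarith [hd x, hd y]
  -- hence `φ x` is constant on the plaques of `U y`
  have hplaque : ∀ x y, ∀ z ∈ (U x).source, ∀ w ∈ (U x).source, z ∈ (U y).source →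
      w ∈ (U y).source → ((U y) z).2 = ((U y) w).2 → ((U x) z).2 = ((U x) w).2 := by
    intro x y z hzx w hwx hzy hwy h
    rw [hUe x z hzx, hUe x w hwx]
    exact (F.foliated _ (hUF y)).snd_eq_of_snd_eq (F.coherent _ (hUF y) _ (hVF x))
      (hUUV x y z hzx hzy) hzy hwy h
  refine ⟨range U, ⟨?_, fun m => ⟨U m, mem_range_self m, hmU m⟩, ?_⟩, ?_⟩
  · rintro _ ⟨x, rfl⟩
    exact hUF x
  · rintro _ ⟨x, rfl⟩ _ ⟨y, rfl⟩
    exact F.exists_transition (hUF x) (hUF y)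
      (fun z hzx w hwx hwy hzy => hplaque y x z hzy w hwy hzx hwx)
      (fun z hzx w hwx hwy hzy => hplaque x y z hzx w hwx hzy hwy)
  · rintro _ ⟨x, rfl⟩
    exact hQ _ (hVF x) (hVQ x) _ (hUF x) (hUV x) (hUe x)

/-! ### Completing independent functions to coordinates -/

/-- Applied in the dual of `E s`, this completes the differentials of the first integrals to a
basis. -/
theorem exists_linearIndependent_castLE {V : Type*} [AddCommGroup V] [Module ℝ V] {r s : ℕ} (hrs : r ≤ s) (hs : s ≤ Module.finrank ℝ V)
    {v : Fin r → V} (hv : LinearIndependent ℝ v) :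
    ∃ w : Fin s → V, LinearIndependent ℝ w ∧ ∀ i, w (Fin.castLE hrs i) = v i := by
  induction s, hrs using Nat.le_induction with
  | base => exact ⟨v, hv, fun i => rfl⟩
  | succ s hrs ih =>
    obtain ⟨w, hw, hwv⟩ := ih (by omega)
    obtain ⟨x, hx⟩ := exists_linearIndependent_snoc_of_lt_finrank hw (by omega)
    refine ⟨_, hx, fun i => ?_⟩
    rw [← hwv i]
    exact Fin.snoc_castSucc (α := fun _ => V) x w (Fin.castLE hrs i)

/-- A smooth map is a diffeomorphism near each point at which its components have independent
differentials. -/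
theorem exists_openPartialHomeomorph_of_linearIndependent {s : ℕ} {H : E s → E s} {T : Set (E s)}
    (hT : IsOpen T) (hH : ContDiffOn ℝ ∞ H T) {q : E s} (hq : q ∈ T)
    (hli : LinearIndependent ℝ
      (fun j => ((EuclideanSpace.proj j : E s →L[ℝ] ℝ).comp (fderiv ℝ H q)).toLinearMap)) :
    ∃ θ : OpenPartialHomeomorph (E s) (E s), ContDiffOn ℝ ∞ θ θ.source ∧
      ContDiffOn ℝ ∞ θ.symm θ.target ∧ q ∈ θ.source ∧ θ.source ⊆ T ∧ ⇑θ = H := by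
  have hat : ∀ x ∈ T, ContDiffAt ℝ ∞ H x := fun x hx => hH.contDiffAt (hT.mem_nhds hx)
  -- The `s` independent covectors span the dual, so every covector vanishes on a vector in the
  -- kernel.
  have hinj : Function.Injective (fderiv ℝ H q) := by
    rw [injective_iff_map_eq_zero]
    intro v hv
    have hspan : Submodule.span ℝ (range (fun j =>
        ((EuclideanSpace.proj j : E s →L[ℝ] ℝ).comp (fderiv ℝ H q)).toLinearMap)) = ⊤ :=
      hli.span_eq_top_of_card_eq_finrank' (by simp [Subspace.dual_finrank_eq])
    refine (Module.forall_dual_apply_eq_zero_iff ℝ v).1 fun φ => ?_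
    have hφ : φ ∈ Submodule.span ℝ (range (fun j =>
        ((EuclideanSpace.proj j : E s →L[ℝ] ℝ).comp (fderiv ℝ H q)).toLinearMap)) := by
      rw [hspan]; trivial
    induction hφ using Submodule.span_induction with
    | mem x hx =>
      obtain ⟨j, rfl⟩ := hx
      simp [hv]
    | zero => simp
    | add x y _ _ hx hy => simp [hx, hy]
    | smul c x _ hx => simp [hx]
  have hequiv : ∃ L : E s ≃L[ℝ] E s, (L : E s →L[ℝ] E s) = fderiv ℝ H q :=
    ⟨(LinearEquiv.ofInjectiveEndo (fderiv ℝ H q).toLinearMap hinj).toContinuousLinearEquiv,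
      by ext; simp⟩
  obtain ⟨L, hL⟩ := hequiv
  have hder : HasFDerivAt H (L : E s →L[ℝ] E s) q := by
    rw [hL]
    exact ((hat q hq).differentiableAt (by simp)).hasFDerivAt
  set θ₀ := (hat q hq).toOpenPartialHomeomorph H hder (by simp)
  have hθ₀ : ⇑θ₀ = H := rfl
  have hqθ : q ∈ θ₀.source := (hat q hq).mem_toOpenPartialHomeomorph_source hder (by simp)
  -- Smoothness of the inverse at a point needs an invertible derivative there, which is an open
  -- condition.
  set O : Set (E s) := T ∩ fderiv ℝ H ⁻¹' range ((↑) : (E s ≃L[ℝ] E s) → E s →L[ℝ] E s)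
  have hO : IsOpen O :=
    (hH.continuousOn_fderiv_of_isOpen hT (by simp)).isOpen_inter_preimage hT
      ContinuousLinearEquiv.isOpen
  refine ⟨θ₀.restrOpen O hO, fun x hx => ?_, fun y hy => ?_, ⟨hqθ, hq, L, hL⟩,
    fun x hx => hx.2.1, rfl⟩
  · exact (hat x hx.2.1).contDiffWithinAt
  · have hx := (θ₀.restrOpen O hO).map_target hy
    obtain ⟨L', hL'⟩ := hx.2.2
    refine ContDiffAt.contDiffWithinAt (OpenPartialHomeomorph.contDiffAt_symm
      (θ₀.restrOpen O hO) (f₀' := L') hy ?_ (hat _ hx.2.1))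
    change HasFDerivAt H _ _
    rw [hL']
    exact ((hat _ hx.2.1).differentiableAt (by simp)).hasFDerivAt

/-! ### Hamiltonian vector fields and the two implications -/

theorem Foliation.diff_submersion_eq_zero (F : Foliation n r s M)
    {e : OpenPartialHomeomorph M (E r × E s)} (he : e ∈ F.charts) {m : M} (hm : m ∈ e.source)
    {v : Tan n m} (hv : v ∈ F.tangent m) (j : Fin s) : diff n (submersion e j) m v = 0 := by
  rw [diff_submersion (F.foliated e he) hm, (F.mem_tangent_iff he hm v).1 hv]
  rfl

theorem Foliation.mem_tangent_of_diff (F : Foliation n r s M)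
    {e : OpenPartialHomeomorph M (E r × E s)} (he : e ∈ F.charts) {m : M} (hm : m ∈ e.source)
    {v : Tan n m} (hv : ∀ j, diff n (submersion e j) m v = 0) : v ∈ F.tangent m := by
  rw [F.mem_tangent_iff he hm v]
  refine PiLp.ext fun j => ?_
  rw [← diff_submersion (F.foliated e he) hm, hv j]
  rfl

theorem PoissonStructure.bivector_swap (P : PoissonStructure n M) (m : M) (α β : Cotan n m) :
    P.bivector m α β = -P.bivector m β α := by
  have h := P.alternating m (α + β)
  simp only [map_add, LinearMap.add_apply, P.alternating] at h
  linarith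

theorem PoissonStructure.diff_ham (P : PoissonStructure n M) (f g : M → ℝ) (m : M) :
    diff n g m (P.ham f m) = P.bracket g f m :=
  P.apply_ham f m _

theorem PoissonStructure.bracket_swap (P : PoissonStructure n M) (f g : M → ℝ) (m : M) :
    P.bracket f g m = -P.bracket g f m :=
  P.bivector_swap m _ _

/-- The chart submersion is constant on the leaves of the restricted foliation. -/
theorem Foliation.isFirstIntegral_submersion (F : Foliation n r s M)
    {e : OpenPartialHomeomorph M (E r × E s)} (he : e ∈ F.charts) (j : Fin s) :
    F.IsFirstIntegral e.source (submersion e j) := by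
  refine ⟨smoothOn_submersion (F.foliated e he) j, fun x _ y _ hxy => ?_⟩
  induction hxy with
  | refl => rfl
  | tail _ h ih =>
    obtain ⟨e', he', hsub, hb, hc, hbc⟩ := h
    rw [ih (hsub hb)]
    exact congrArg (fun z : E s => z j)
      ((F.foliated e' he').snd_eq_of_snd_eq (F.coherent e' he' e he) hsub hb hc hbc)

theorem IsRegularFoliatedAtlas.isAbstractNCI (hrs : r + s = n) {P : PoissonStructure n M}
    {F : Foliation n r s M} {A : Set (OpenPartialHomeomorph M (E r × E s))}
    (hA : IsRegularFoliatedAtlas F A)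
    (h : ∀ e ∈ A, IsRegularNCISystem P r e.source (submersion e)) : IsAbstractNCI P F := by
  intro m
  obtain ⟨e, heA, hm⟩ := hA.cover m
  have he := hA.subset heA
  have hN := h e heA
  have hle : r ≤ s := by
    have := hN.dim_le
    omega
  refine ⟨e.source, e.open_source, hm, fun i => submersion e (Fin.castLE hle i),
    fun i => F.isFirstIntegral_submersion he _, fun x hx => ?_⟩
  have hli : LinearIndependent ℝ (fun i : Fin r => P.ham (submersion e (Fin.castLE hle i)) x) :=
    (hN.regular x hx).2.comp (fun i : Fin r => ⟨Fin.castLE hle i, i.2⟩) fun i j hij => by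
      simpa [Fin.ext_iff] using hij
  -- Involution gives the inclusion; both spaces have dimension `r`.
  refine Submodule.eq_of_le_of_finrank_eq (Submodule.span_le.2 ?_) ?_
  · rintro _ ⟨i, rfl⟩
    refine F.mem_tangent_of_diff he hx fun j => ?_
    rw [P.diff_ham, P.bracket_swap, hN.involution _ j i.2 x hx, neg_zero]
  · rw [finrank_span_eq_card hli, F.finrank_tangent hrs, Fintype.card_fin]

theorem diff_congr {f g : M → ℝ} {m : M} (h : f =ᶠ[𝓝 m] g) : diff n f m = diff n g m := by
  rw [diff, diff, h.mfderiv_eq]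

theorem PoissonStructure.ham_congr (P : PoissonStructure n M) {f g : M → ℝ} {m : M}
    (h : f =ᶠ[𝓝 m] g) : P.ham f m = P.ham g m := by
  rw [PoissonStructure.ham, diff_congr h, PoissonStructure.ham]

/-- The Hamiltonian vector fields of the first `r` components of the submersion of `e` span the
tangent bundle of the foliation. -/
def Foliation.HamSpan (F : Foliation n r s M) (P : PoissonStructure n M)
    (e : OpenPartialHomeomorph M (E r × E s)) : Prop :=
  ∃ h : r ≤ s, ∀ x ∈ e.source,
    Submodule.span ℝ (range fun i => P.ham (submersion e (Fin.castLE h i)) x) = F.tangent x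

/-- This is the stability under shrinking required of the class `Q` in the atlas extraction. -/
theorem Foliation.HamSpan.restrict {F : Foliation n r s M} {P : PoissonStructure n M}
    {e e' : OpenPartialHomeomorph M (E r × E s)} (h : F.HamSpan P e)
    (hsub : e'.source ⊆ e.source) (heq : ∀ x ∈ e'.source, (e' x).2 = (e x).2) :
    F.HamSpan P e' := by
  obtain ⟨hle, h⟩ := h
  refine ⟨hle, fun x hx => ?_⟩
  rw [← h x (hsub hx)]
  congr 2
  funext i
  refine P.ham_congr ?_
  filter_upwards [e'.open_source.mem_nhds hx] with y hy
  simp only [submersion, heq y hy]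

theorem Foliation.linearIndependent_ham_of_span_eq (F : Foliation n r s M)
    (hrs : r + s = n) {P : PoissonStructure n M} {f : Fin r → M → ℝ} {x : M}
    (h : Submodule.span ℝ (range fun i => P.ham (f i) x) = F.tangent x) :
    LinearIndependent ℝ (fun i => P.ham (f i) x) := by
  rw [linearIndependent_iff_card_eq_finrank_span, Set.finrank, h, F.finrank_tangent hrs,
    Fintype.card_fin]

theorem Foliation.HamSpan.isRegularNCISystem {F : Foliation n r s M} (hrs : r + s = n)
    {P : PoissonStructure n M} {e : OpenPartialHomeomorph M (E r × E s)} (he : e ∈ F.charts)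
    (h : F.HamSpan P e) : IsRegularNCISystem P r e.source (submersion e) := by
  obtain ⟨hle, h⟩ := h
  have hreg : ∀ m ∈ e.source, IsRegularPoint P r (submersion e) m := fun m hm =>
    ⟨linearIndependent_diff_submersion (F.foliated e he) hm,
      (F.linearIndependent_ham_of_span_eq hrs (h m hm)).comp
        (fun i : {i : Fin s // (i : ℕ) < r} => (⟨i, i.2⟩ : Fin r))
        fun i j hij => by simpa [Fin.ext_iff, Subtype.ext_iff] using hij⟩
  refine { isOpen := e.open_source, dim_le := by omega, rank_eq := hrs,
           smooth := smoothOn_submersion (F.foliated e he), involution := ?_,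
           dense_regular := ⟨e.source, Subset.rfl, e.open_source, subset_closure, hreg⟩,
           regular := hreg }
  intro i j hi m hm
  rw [P.bracket_swap, ← P.diff_ham, neg_eq_zero]
  refine F.diff_submersion_eq_zero he hm ?_ j
  rw [← h m hm]
  exact Submodule.subset_span ⟨⟨i, hi⟩, rfl⟩

/-- An abstract NCI system admits around each point a foliated chart whose submersion starts with
first integrals having Hamiltonian vector fields that span the foliation. -/
theorem IsAbstractNCI.exists_hamSpan (hrs : r + s = n) {P : PoissonStructure n M}
    {F : Foliation n r s M} (h : IsAbstractNCI P F) (m : M) :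
    ∃ e ∈ F.charts, m ∈ e.source ∧ F.HamSpan P e := by
  obtain ⟨U, hU, hmU, f, hf, hspan⟩ := h m
  obtain ⟨c, hcF, hmc⟩ := F.cover m
  obtain ⟨e, he, hm, heU, -, -⟩ := F.exists_chart_subset hcF hmc (hU.mem_nhds hmU)
  have hef := F.foliated e he
  set p := (e m).1
  set q := (e m).2
  -- The transversal of `e` through `m`. Since `e.target` is a product, it meets every plaque of
  -- `e`.
  let T : Set (E s) := {q' | (p, q') ∈ e.target}
  have hT : IsOpen T := e.open_target.preimage (by fun_prop)
  have hφT : ∀ x ∈ e.source, (e x).2 ∈ T := by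
    obtain ⟨A, B, -, -, hAB⟩ := hef.box
    intro x hx
    have h1 := e.map_source hm
    have h2 := e.map_source hx
    rw [hAB] at h1 h2
    change (p, (e x).2) ∈ e.target
    rw [hAB]
    exact ⟨h1.1, h2.2⟩
  -- the first integrals as functions on the transversal
  let g : Fin r → E s → ℝ := fun i q' => f i (e.symm (p, q'))
  have hg : ∀ i, ContDiffOn ℝ ∞ (g i) T := by
    intro i
    rw [← contMDiffOn_iff_contDiffOn]
    refine ContMDiffOn.comp (g := f i) (f := fun q' => e.symm (p, q')) (hf i).1
      (hef.smooth_symm.comp (f := fun q' : E s => (p, q'))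
        (contDiff_const.prodMk contDiff_id).contMDiff.contMDiffOn fun q' hq' => hq')
      fun q' hq' => heU (e.map_target hq')
  -- The plaque of `x` meets the transversal, and stays inside `U`, so `f i` takes the same value
  -- there.
  have hgf : ∀ i, ∀ x ∈ e.source, f i x = g i (e x).2 := by
    intro i x hx
    have ht : (p, (e x).2) ∈ e.target := hφT x hx
    refine (hf i).2 x (heU hx) _ (heU (e.map_target ht))
      (Relation.ReflTransGen.single ⟨e, he, heU, hx, e.map_target ht, ?_⟩)
    rw [e.right_inv ht]
  have hgd : ∀ i, DifferentiableAt ℝ (g i) q := fun i =>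
    ((hg i).contDiffAt (hT.mem_nhds (hφT m hm))).differentiableAt (by simp)
  let L : E n →ₗ[ℝ] E s := ContinuousLinearMap.toLinearMap (M := E n) (M₂ := E s)
    (mfderiv (𝓡 n) 𝓘(ℝ, E s) (fun x => (e x).2) m)
  have hdf : ∀ i, diff n (f i) m = L.dualMap (fderiv ℝ (g i) q).toLinearMap := by
    intro i
    have h1 : f i =ᶠ[𝓝 m] fun x => g i (e x).2 := by
      filter_upwards [e.open_source.mem_nhds hm] with x hx using hgf i x hx
    have h2 := (hgd i).hasFDerivAt.hasMFDerivAt.comp m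
      ((hef.contMDiffAt_snd hm).mdifferentiableAt (by simp)).hasMFDerivAt
    have h3 : mfderiv (𝓡 n) 𝓘(ℝ, ℝ) (fun x => g i (e x).2) m = _ := h2.mfderiv
    rw [diff_congr h1, diff, h3]
    rfl
  -- The Hamiltonian fields are linear images of the `df i`, themselves the images of the `dg i`
  -- under the dual of `dφ`; independence passes back through both maps.
  have hli : LinearIndependent ℝ (fun i => (fderiv ℝ (g i) q).toLinearMap) := by
    have h1 := F.linearIndependent_ham_of_span_eq hrs (hspan m hmU)
    have h2 : LinearIndependent ℝ (fun i => diff n (f i) m) :=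
      LinearIndependent.of_comp
        ((Module.evalEquiv ℝ (Tan n m)).symm.toLinearMap ∘ₗ (P.bivector m).flip) h1
    simp_rw [hdf] at h2
    exact LinearIndependent.of_comp L.dualMap h2
  have hle : r ≤ s := by
    simpa [Subspace.dual_finrank_eq] using hli.fintype_card_le_finrank
  obtain ⟨w, hw, hwg⟩ := exists_linearIndependent_castLE hle
    (by simp [Subspace.dual_finrank_eq]) hli
  -- Linear functions complete the `g i`, so that the components of `dH` at `q` are exactly the
  -- basis `w`.
  let H : E s → E s := fun q' => WithLp.toLp 2 fun j : Fin s =>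
    if hj : (j : ℕ) < r then g ⟨j, hj⟩ q' else w j q'
  have hHj : ∀ j : Fin s, (∃ hj : (j : ℕ) < r, (fun q' => H q' j) = g ⟨j, hj⟩) ∨
      (fun q' => H q' j) = LinearMap.toContinuousLinearMap (w j) := by
    intro j
    by_cases hj : (j : ℕ) < r
    · exact Or.inl ⟨hj, by funext q'; simp [H, hj]⟩
    · exact Or.inr (by funext q'; simp [H, hj])
  have hH : ContDiffOn ℝ ∞ H T := by
    rw [contDiffOn_euclidean]
    intro j
    rcases hHj j with ⟨hj, h⟩ | h
    · rw [h]; exact hg _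
    · rw [h]; exact (LinearMap.toContinuousLinearMap (w j)).contDiff.contDiffOn
  have hHd : DifferentiableAt ℝ H q :=
    (hH.contDiffAt (hT.mem_nhds (hφT m hm))).differentiableAt (by simp)
  have hHw : ∀ j : Fin s,
      ((EuclideanSpace.proj j : E s →L[ℝ] ℝ).comp (fderiv ℝ H q)).toLinearMap = w j := by
    intro j
    have h1 : HasFDerivAt (fun q' => H q' j)
        ((EuclideanSpace.proj j : E s →L[ℝ] ℝ).comp (fderiv ℝ H q)) q :=
      (EuclideanSpace.proj j : E s →L[ℝ] ℝ).hasFDerivAt.comp q hHd.hasFDerivAt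
    rcases hHj j with ⟨hj, h⟩ | h
    · rw [h] at h1
      rw [← h1.fderiv]
      exact (hwg ⟨j, hj⟩).symm
    · rw [h] at h1
      rw [h1.unique (LinearMap.toContinuousLinearMap (w j)).hasFDerivAt]
      rfl
  obtain ⟨θ, hθ, hθ', hqθ, -, hθH⟩ := exists_openPartialHomeomorph_of_linearIndependent hT hH
    (hφT m hm) (by rwa [show w = _ from (funext hHw).symm] at hw)
  obtain ⟨e', he', hm', -, hsub, hval⟩ := F.exists_chart_comp he hm θ hθ hθ' hqθ univ_mem
  -- The first `r` components of `θ ∘ φ` are the `f i` on all of `e'.source`, and these span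
  -- throughout `U`.
  refine ⟨e', he', hm', hle, fun x hx => ?_⟩
  rw [← hspan x (heU (hsub hx))]
  congr 2
  funext i
  refine P.ham_congr ?_
  filter_upwards [e'.open_source.mem_nhds hx] with y hy
  rw [hgf i y (hsub hy), submersion, (hval y hy).2, hθH]
  simp [H]

end NCI

theorem mainTheorem5 {n r s : ℕ} (hrs : r + s = n)
    {M : Type*} [TopologicalSpace M] [T2Space M] [SecondCountableTopology M]
    [ChartedSpace (NCI.E n) M] [IsManifold (𝓡 n) ∞ M]
    (P : NCI.PoissonStructure n M) (F : NCI.Foliation n r s M) :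
    NCI.IsAbstractNCI P F ↔
      ∃ A : Set (OpenPartialHomeomorph M (NCI.E r × NCI.E s)),
        NCI.IsRegularFoliatedAtlas F A ∧
        ∀ e ∈ A, NCI.IsRegularNCISystem P r e.source (NCI.submersion e) := by
  constructor
  · intro h
    obtain ⟨A, hA, hAQ⟩ := F.exists_regularFoliatedAtlas (F.HamSpan P)
      (fun e _ he e' _ hsub heq => he.restrict hsub heq) (h.exists_hamSpan hrs)
    exact ⟨A, hA, fun e he => (hAQ e he).isRegularNCISystem hrs (hA.subset he)⟩
  · rintro ⟨A, hA, h⟩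
    exact hA.isAbstractNCI hrs h
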